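/- Let $\mathcal H$ be a complex Hilbert space, $\mathcal A$ a unital $O^*$-algebra on a dense subspace $\mathcal D\subseteq\mathcal H$ (an algebra of linear maps $\mathcal D\to\mathcal D$ containing the identity such that for each $\hat A\in\mathcal A$ the Hilbert space adjoint satisfies $\hat A^*\mathcal D\subseteq\mathcal D$ and $\hat A^*|_{\mathcal D}\in\mathcal A$). Let $\mathcal T_1(\mathcal A)$ be the set of trace class operators $T$ with $T\mathcal H\subseteq\mathcal D$, $T^*\mathcal H\subseteq\mathcal D$ and $\hat AT,\hat AT^*$ trace class for all $\hat A\in\mathcal A$. A state is a positive operator $\rho\in\mathcal T_1(\mathcal A)$ with $\mathrm{Tr}\,\rho=1$; write $\nu(\rho_1,\delta)=\{\rho \text{ a state}:\mathrm{Tr}|\rho-\rho_1|<\delta\}$, where $|T|=\sqrt{T^*T}$. Let $\hat A\in\mathcal A$ be essentially self-adjoint, let $I_a\subset\mathbb R$ be a bounded interval (open, closed or half-open) with midpoint $a_0$ and width $|I_a|>0$, and let $\hat P=\hat P^{\hat A}(I_a)$ be the spectral projection on $I_a$ of the closure of $\hat A$. For a state $\rho$ put $a_Q(\rho)=\mathrm{Tr}(\hat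 A\rho)$, $a^2_Q(\rho)=\mathrm{Tr}(\hat A^2\rho)$ and $s(a)_Q=\sqrt{a^2_Q-(a_Q)^2}$. For $0<\varepsilon<1$ and a set $W$ of states, $\hat A$ is *$\varepsilon$ sharp collimated on $I_a$ in $W$* if for all $\rho\in W$ $$|a_Q(\rho)-a_0|\le \tfrac{\varepsilon}{2}|I_a|,\qquad a_0-\tfrac{|I_a|}{2}\le a_Q(\rho)-\tfrac{s(a)_Q(\rho)}{\sqrt\varepsilon},\qquad a_Q(\rho)+\tfrac{s(a)_Q(\rho)}{\sqrt\varepsilon}\le a_0+\tfrac{|I_a|}{2},$$ and *strictly $\varepsilon$ sharp collimated on $I_a$ in $W$* if, in addition, $\mathrm{Tr}|\rho-\hat P\rho\hat P|<\varepsilon$ for all $\rho\in W$. **Theorem.** Let $\rho_m=|\psi_m\rangle\langle\psi_m|$ be a pure state, with $\psi_m\in\mathcal D$ and $\hat A\psi_m=a_0\psi_m$. Let $\varepsilon>0$ and $0<\delta<\varepsilon/3$ be such that $\mathrm{Tr}|\hat P\rho_m\hat P-\rho_m|<\delta$. If $\hat A$ is $\varepsilon$ sharp collimated on $I_a$ in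 $\nu(\rho_m,\delta)$, then $\hat A$ is strictly $\varepsilon$ sharp collimated on $I_a$ in $\nu(\rho_m,\delta)$; in particular $\mathrm{Tr}|\rho-\hat P\rho\hat P|<\varepsilon$ for all $\rho\in\nu(\rho_m,\delta)$. -/

import Mathlib

open MeasureTheory
open scoped ENNReal InnerProductSpace

noncomputable section

/-! ### Trace and trace norm -/

section Trace

variable {H : Type*} [NormedAddCommGroup H] [InnerProductSpace ℂ H] [CompleteSpace H]

/-- Index set of a fixed orthonormal basis of `H`. -/
def onbIndex (H : Type*) [NormedAddCommGroup H] [InnerProductSpace ℂ H] [CompleteSpace H] :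
    Set H :=
  (exists_hilbertBasis ℂ H).choose

/-- A fixed orthonormal (Hilbert) basis of `H`, used to compute traces. The traces of positive
operators and of trace class operators do not depend on it. -/
def onb (H : Type*) [NormedAddCommGroup H] [InnerProductSpace ℂ H] [CompleteSpace H] :
    HilbertBasis (onbIndex H) ℂ H :=
  (exists_hilbertBasis ℂ H).choose_spec.choose

/-- `Tr |T| ∈ [0, ∞]`, where `|T| = √(T* T)`. -/
def traceNorm (T : H →L[ℂ] H) : ℝ≥0∞ :=
  ∑' i, ENNReal.ofReal (⟪onb H i, (CFC.abs T : H →L[ℂ] H) (onb H i)⟫_ℂ).re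

/-- An everywhere defined operator is trace class if it is bounded and `Tr |T| < ∞`. -/
def IsTraceClass (T : H →ₗ[ℂ] H) : Prop :=
  ∃ S : H →L[ℂ] H, (∀ x, S x = T x) ∧ traceNorm S < ∞

/-- The trace `∑ ⟨eᵢ, T eᵢ⟩` (an absolutely convergent series if `T` is trace class). -/
def opTrace (T : H →ₗ[ℂ] H) : ℂ :=
  ∑' i, ⟪onb H i, T (onb H i)⟫_ℂ

end Trace

/-! ### Operator algebras on a dense domain, and their states -/

/-- A unital `O*`-algebra on the dense domain `D ⊆ H`: a subalgebra of the linear maps `D → D`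
in which every `A` has an adjoint `A†`, that is, `A* D ⊆ D` and `A†`, the restriction of the
Hilbert space adjoint `A*` to `D`, is again in the algebra. -/
structure OStarAlgebra (H : Type*) [NormedAddCommGroup H] [InnerProductSpace ℂ H] where
  /-- the common invariant domain -/
  D : Submodule ℂ H
  dense_D : Dense (D : Set H)
  /-- the operators -/
  alg : Subalgebra ℂ (Module.End ℂ D)
  exists_adjoint : ∀ A ∈ alg, ∃ B ∈ alg, ∀ x y : D, ⟪(A x : H), (y : H)⟫_ℂ = ⟪(x : H), (B y : H)⟫_ℂ

namespace OStarAlgebra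

variable {H : Type*} [NormedAddCommGroup H] [InnerProductSpace ℂ H]

/-- An operator `A : D → D` seen as a densely defined operator in `H` with domain `D`. -/
def toPMap (𝒜 : OStarAlgebra H) (A : Module.End ℂ 𝒜.D) : H →ₗ.[ℂ] H :=
  ⟨𝒜.D, 𝒜.D.subtype ∘ₗ A⟩

variable [CompleteSpace H]

/-- `A` is essentially self-adjoint on `D`: its closure is self-adjoint. -/
def IsEssSelfAdjoint (𝒜 : OStarAlgebra H) (A : Module.End ℂ 𝒜.D) : Prop :=
  (𝒜.toPMap A).IsClosable ∧ IsSelfAdjoint (𝒜.toPMap A).closure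

/-- The everywhere defined operator `A T` on `H`, for an operator `T` with range in `D`. -/
def lcomp (𝒜 : OStarAlgebra H) (A : Module.End ℂ 𝒜.D) (T : H →L[ℂ] H) (hT : ∀ x, T x ∈ 𝒜.D) :
    H →ₗ[ℂ] H :=
  𝒜.D.subtype ∘ₗ A ∘ₗ (T : H →ₗ[ℂ] H).codRestrict 𝒜.D hT

/-- The set `𝒯₁(𝒜)` of the trace class operators `T` with `T H ⊆ D`, `T* H ⊆ D` such that
`A T` and `A T*` are trace class for every `A` in `𝒜`. -/
structure MemT₁ (𝒜 : OStarAlgebra H) (T : H →L[ℂ] H) : Prop where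
  traceClass : traceNorm T < ∞
  range : ∀ x, T x ∈ 𝒜.D
  adjoint_range : ∀ x, (ContinuousLinearMap.adjoint T) x ∈ 𝒜.D
  mul : ∀ A ∈ 𝒜.alg, IsTraceClass (𝒜.lcomp A T range)
  mul_adjoint : ∀ A ∈ 𝒜.alg,
    IsTraceClass (𝒜.lcomp A (ContinuousLinearMap.adjoint T) adjoint_range)

/-- The states of `𝒜`: the density operators (positive, of trace one) in `𝒯₁(𝒜)`. -/
structure State (𝒜 : OStarAlgebra H) where
  /-- the density operator -/
  op : H →L[ℂ] H
  mem : 𝒜.MemT₁ op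
  pos : op.IsPositive
  trace_one : opTrace (op : H →ₗ[ℂ] H) = 1

/-- The trace norm ball `ν(ρ₁; δ) = {ρ : Tr |ρ - ρ₁| < δ}` in the state space. -/
def ball {𝒜 : OStarAlgebra H} (ρ₁ : 𝒜.State) (δ : ℝ) : Set 𝒜.State :=
  {ρ | traceNorm (ρ.op - ρ₁.op) < ENNReal.ofReal δ}

/-- The quantum real number value `a_Q : ρ ↦ Tr (A ρ)` of `A`. For essentially self-adjoint
`A` the trace is real. -/
def qr (𝒜 : OStarAlgebra H) (A : Module.End ℂ 𝒜.D) (ρ : 𝒜.State) : ℝ :=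
  (opTrace (𝒜.lcomp A ρ.op ρ.mem.range)).re

/-- `s(a)_Q = √((a²)_Q - (a_Q)²)`. -/
def qrDev (𝒜 : OStarAlgebra H) (A : Module.End ℂ 𝒜.D) (ρ : 𝒜.State) : ℝ :=
  √(𝒜.qr (A * A) ρ - 𝒜.qr A ρ ^ 2)

end OStarAlgebra

/-! ### Spectral projections -/

/-- A projection-valued measure on the Borel sets of `ℝ`: orthogonal projections, countably
additive in the strong operator topology, with `E(ℝ) = 1`. (`E(∅) = 0` and
`E(B ∩ C) = E(B) E(C)` follow.) -/
structure PVM (H : Type*) [NormedAddCommGroup H] [InnerProductSpace ℂ H] [CompleteSpace H] where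
  /-- the projections -/
  proj : Set ℝ → H →L[ℂ] H
  isProj : ∀ B, MeasurableSet B → IsStarProjection (proj B)
  univ : proj Set.univ = 1
  iUnion : ∀ B : ℕ → Set ℝ, (∀ n, MeasurableSet (B n)) → Pairwise (Function.onFun Disjoint B) →
    ∀ x, HasSum (fun n => proj (B n) x) (proj (⋃ n, B n) x)

namespace PVM

variable {H : Type*} [NormedAddCommGroup H] [InnerProductSpace ℂ H] [CompleteSpace H]

theorem inner_proj (E : PVM H) {B : Set ℝ} (hB : MeasurableSet B) (x : H) :
    (⟪x, E.proj B x⟫_ℂ).re = ‖E.proj B x‖ ^ 2 := by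
  have h1 := (E.isProj B hB).isIdempotentElem
  have h2 := (E.isProj B hB).isSelfAdjoint
  have h3 : E.proj B x = E.proj B (E.proj B x) := by
    conv_lhs => rw [← h1]
    rfl
  have h4 : ⟪x, E.proj B (E.proj B x)⟫_ℂ = ⟪E.proj B x, E.proj B x⟫_ℂ := by
    rw [← ContinuousLinearMap.adjoint_inner_left, h2.adjoint_eq]
  rw [h3, h4, ← h3, inner_self_eq_norm_sq_to_K]
  norm_cast

theorem proj_empty (E : PVM H) : E.proj ∅ = 0 := by
  ext x
  have h := E.iUnion (fun _ => ∅) (fun _ => MeasurableSet.empty)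
    (fun _ _ _ => by simp [Function.onFun]) x
  simpa using tendsto_nhds_unique h.summable.tendsto_atTop_zero tendsto_const_nhds |>.symm

/-- The scalar spectral measure `B ↦ ⟨x, E(B) x⟩ = ‖E(B) x‖²`. -/
def measure (E : PVM H) (x : H) : Measure ℝ :=
  Measure.ofMeasurable (fun B _ => ENNReal.ofReal (⟪x, E.proj B x⟫_ℂ).re)
    (by simp [E.proj_empty])
    (by
      intro f hf hd
      have h1 := (E.iUnion f hf hd x).mapL (innerSL ℂ x)
      have h2 := h1.mapL Complex.reCLM
      simp only [innerSL_apply_apply, Complex.reCLM_apply] at h2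
      rw [← h2.tsum_eq, ENNReal.ofReal_tsum_of_nonneg (fun n => ?_) h2.summable]
      rw [E.inner_proj (hf n)]
      positivity)

/-- `E` is the spectral measure of the operator `T`, that is, `T = ∫ t dE(t)`: the domain of `T`
is `{x : ∫ t² d⟨x, E(t) x⟩ < ∞}`, and `⟨x, T x⟩ = ∫ t d⟨x, E(t) x⟩` there. -/
def IsSpectralMeasureOf (E : PVM H) (T : H →ₗ.[ℂ] H) : Prop :=
  (∀ x : H, x ∈ T.domain ↔ ∫⁻ t, ENNReal.ofReal (t ^ 2) ∂(E.measure x) < ∞) ∧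
  ∀ x : T.domain, ⟪(x : H), T x⟫_ℂ = ((∫ t, t ∂(E.measure (x : H)) : ℝ) : ℂ)

end PVM

/-! ### Sharp collimation -/

/-- `I` is a bounded interval (open, closed or half-open) with midpoint `a₀` and width `w`. -/
def IsIntervalAt (I : Set ℝ) (a₀ w : ℝ) : Prop :=
  0 < w ∧ Set.Ioo (a₀ - w / 2) (a₀ + w / 2) ⊆ I ∧ I ⊆ Set.Icc (a₀ - w / 2) (a₀ + w / 2)

namespace OStarAlgebra

variable {H : Type*} [NormedAddCommGroup H] [InnerProductSpace ℂ H] [CompleteSpace H]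

/-- `A` is `ε` sharp collimated, in the interval with midpoint `a₀` and width `w`, on the set `W`
of states. Inequalities between quantum real numbers on `W` hold at every state of `W`. -/
def IsSharpCollimated (𝒜 : OStarAlgebra H) (A : Module.End ℂ 𝒜.D) (a₀ w ε : ℝ)
    (W : Set 𝒜.State) : Prop :=
  0 < ε ∧ ε < 1 ∧ ∀ ρ ∈ W,
    |𝒜.qr A ρ - a₀| ≤ ε * w / 2 ∧
    a₀ - w / 2 ≤ 𝒜.qr A ρ - 𝒜.qrDev A ρ / √ε ∧
    𝒜.qr A ρ + 𝒜.qrDev A ρ / √ε ≤ a₀ + w / 2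

/-- Strict `ε` sharp collimation on `W`, where `P` is the spectral projection of `A` on the
interval: in addition, `Tr |ρ - P ρ P| < ε` for every `ρ` in `W`. -/
def IsStrictSharpCollimated (𝒜 : OStarAlgebra H) (A : Module.End ℂ 𝒜.D) (P : H →L[ℂ] H)
    (a₀ w ε : ℝ) (W : Set 𝒜.State) : Prop :=
  𝒜.IsSharpCollimated A a₀ w ε W ∧
    ∀ ρ ∈ W, traceNorm (ρ.op - P * ρ.op * P) < ENNReal.ofReal ε

end OStarAlgebra

end

/-!
The difference `ρ - PρP` telescopes as `(ρ - ρₘ) - (PρₘP - ρₘ) - P(ρ - ρₘ)P`. The first two terms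
have trace norm less than `δ` by hypothesis, and so has the third, as compression by a projection
does not increase the trace norm. The triangle inequality gives `Tr |ρ - PρP| < 3δ < ε`.

All the operators involved are self-adjoint, so both properties of the trace norm are only needed
for self-adjoint operators. They follow from one variational bound, `traceNorm_sub_le`:
`Tr |A - B| ≤ Tr A + Tr B` for positive `A` and `B`, with equality for the Jordan decomposition
(`traceNorm_eq_posTrace_add`). The compression estimate moreover uses `Tr (CAC*) ≤ ‖C‖² Tr A` for
positive `A` (`posTrace_conj_le`), which is Parseval's identity for the Hilbert-Schmidt norms of
`S C*` and `C S*`, where `A = S* S`.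
-/

open ContinuousLinearMap

section TraceNorm

variable {H : Type*} [NormedAddCommGroup H] [InnerProductSpace ℂ H]

/-! ### The trace of a positive operator -/

theorem re_inner_apply_nonneg {A : H →L[ℂ] H} (hA : 0 ≤ A) (x : H) : 0 ≤ (⟪x, A x⟫_ℂ).re :=
  ((nonneg_iff_isPositive A).1 hA).re_inner_nonneg_right x

/-- Parseval's identity in `[0, ∞]`, where double sums may be exchanged freely. -/
theorem HilbertBasis.tsum_enorm_inner_sq {ι : Type*} (b : HilbertBasis ι ℂ H) (x : H) :
    ∑' i, ‖⟪b i, x⟫_ℂ‖ₑ ^ 2 = ‖x‖ₑ ^ 2 := by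
  have h : HasSum (fun i => ‖⟪b i, x⟫_ℂ‖ ^ 2) (‖x‖ ^ 2) := by
    have h1 := (b.hasSum_inner_mul_inner x x).mapL Complex.reCLM
    convert! h1 using 1
    · ext i
      refine Eq.trans ?_ (inner_mul_symm_re_eq_norm (𝕜 := ℂ) x (b i)).symm
      rw [norm_mul, norm_inner_symm x, sq]
    · exact (inner_self_eq_norm_sq (𝕜 := ℂ) x).symm
  have e : ∀ r : ℝ, 0 ≤ r → ENNReal.ofReal (r ^ 2) = ENNReal.ofReal r ^ 2 :=
    fun r hr => ENNReal.ofReal_pow hr 2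
  rw [← ofReal_norm x, ← e _ (norm_nonneg _), ← h.tsum_eq,
    ENNReal.ofReal_tsum_of_nonneg (fun _ => by positivity) h.summable]
  simp_rw [e _ (norm_nonneg _), ofReal_norm]

variable [CompleteSpace H]

/-- The trace `∑ ⟨eᵢ, A eᵢ⟩ ∈ [0, ∞]` of a positive operator `A`, in the fixed orthonormal basis.
Negative terms, which do not occur for positive `A`, are truncated to `0`. -/
noncomputable def posTrace (A : H →L[ℂ] H) : ℝ≥0∞ :=
  ∑' i, ENNReal.ofReal (⟪onb H i, A (onb H i)⟫_ℂ).re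

theorem traceNorm_eq_posTrace_abs (T : H →L[ℂ] H) : traceNorm T = posTrace (CFC.abs T) := rfl

theorem posTrace_add {A B : H →L[ℂ] H} (hA : 0 ≤ A) (hB : 0 ≤ B) :
    posTrace (A + B) = posTrace A + posTrace B := by
  rw [posTrace, posTrace, posTrace, ← ENNReal.tsum_add]
  refine tsum_congr fun i => ?_
  rw [← ENNReal.ofReal_add (re_inner_apply_nonneg hA _) (re_inner_apply_nonneg hB _), add_apply,
    inner_add_right, Complex.add_re]

theorem posTrace_mono {A B : H →L[ℂ] H} (h : A ≤ B) : posTrace A ≤ posTrace B := by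
  refine ENNReal.tsum_le_tsum fun i => ENNReal.ofReal_le_ofReal ?_
  have := re_inner_apply_nonneg (sub_nonneg.2 h) (onb H i)
  rw [sub_apply, inner_sub_right, Complex.sub_re] at this
  linarith

/-- An operator and its adjoint have the same Hilbert-Schmidt norm. -/
theorem tsum_enorm_adjoint_apply_sq (S : H →L[ℂ] H) :
    ∑' i, ‖adjoint S (onb H i)‖ₑ ^ 2 = ∑' i, ‖S (onb H i)‖ₑ ^ 2 := by
  simp_rw [← (onb H).tsum_enorm_inner_sq]
  rw [ENNReal.tsum_comm]
  refine tsum_congr fun i => tsum_congr fun j => ?_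
  rw [adjoint_inner_right, ← ofReal_norm, ← ofReal_norm, norm_inner_symm]

theorem posTrace_star_mul_self (S : H →L[ℂ] H) :
    posTrace (star S * S) = ∑' i, ‖S (onb H i)‖ₑ ^ 2 := by
  refine tsum_congr fun i => ?_
  rw [star_eq_adjoint, mul_def, comp_apply, adjoint_inner_right, ← ofReal_norm,
    ← ENNReal.ofReal_pow (norm_nonneg _)]
  exact congrArg _ (inner_self_eq_norm_sq (𝕜 := ℂ) _)

theorem posTrace_conj_le {A : H →L[ℂ] H} (hA : 0 ≤ A) (C : H →L[ℂ] H) :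
    posTrace (C * A * star C) ≤ ‖C‖ₑ ^ 2 * posTrace A := by
  obtain ⟨S, rfl⟩ := CStarAlgebra.nonneg_iff_eq_star_mul_self.1 hA
  -- With `A = S* S`, both traces are squared Hilbert-Schmidt norms, those of `S C*` and of `S`.
  have h : C * (star S * S) * star C = star (S * star C) * (S * star C) := by
    simp only [star_mul, star_star, mul_assoc]
  rw [h, posTrace_star_mul_self, posTrace_star_mul_self, ← tsum_enorm_adjoint_apply_sq,
    ← tsum_enorm_adjoint_apply_sq S, ← ENNReal.tsum_mul_left]
  refine ENNReal.tsum_le_tsum fun i => ?_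
  rw [← star_eq_adjoint, star_mul, star_star, mul_def, comp_apply, ← mul_pow, star_eq_adjoint]
  gcongr
  exact C.le_opENorm _

theorem IsStarProjection.posTrace_conj_le {P : H →L[ℂ] H} (hP : IsStarProjection P)
    {A : H →L[ℂ] H} (hA : 0 ≤ A) : posTrace (P * A * P) ≤ posTrace A := by
  have h := _root_.posTrace_conj_le hA P
  rw [hP.isSelfAdjoint.star_eq] at h
  refine h.trans (mul_le_of_le_one_left' (pow_le_one' ?_ 2))
  rw [← ofReal_norm]
  exact ENNReal.ofReal_le_one.2 hP.norm_le

/-! ### The trace norm of self-adjoint operators -/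

theorem traceNorm_eq_posTrace_add {T : H →L[ℂ] H} (hT : IsSelfAdjoint T) :
    traceNorm T = posTrace T⁺ + posTrace T⁻ := by
  rw [traceNorm_eq_posTrace_abs, ← CFC.posPart_add_negPart T hT,
    posTrace_add (CFC.posPart_nonneg T) (CFC.negPart_nonneg T)]

/-- A projection separating two positive operators with product `0`. -/
theorem exists_isStarProjection_mul_eq_zero {A B : H →L[ℂ] H} (hA : IsSelfAdjoint A)
    (hB : IsSelfAdjoint B) (hAB : A * B = 0) :
    ∃ Q : H →L[ℂ] H, IsStarProjection Q ∧ A * Q = 0 ∧ Q * A = 0 ∧ Q * B = B ∧ B * Q = B := by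
  -- `Q` projects onto `ker A`, which contains the range of `B`.
  let K : Submodule ℂ H := A.ker
  have : CompleteSpace K := A.isClosed_ker.completeSpace_coe
  have hQ : IsStarProjection K.starProjection := isStarProjection_starProjection
  have h1 : A * K.starProjection = 0 := by
    ext x
    exact K.starProjection_apply_mem x
  have h2 : K.starProjection * B = B := by
    ext x
    refine Submodule.starProjection_eq_self_iff.2 ?_
    exact DFunLike.congr_fun hAB x
  refine ⟨K.starProjection, hQ, h1, ?_, h2, ?_⟩
  · simpa [hA.star_eq, hQ.isSelfAdjoint.star_eq] using congrArg star h1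
  · simpa [hB.star_eq, hQ.isSelfAdjoint.star_eq] using congrArg star h2

/-- The variational bound for the trace norm of a self-adjoint operator. With `Q` separating the
positive and negative parts of `T = A - B` and `R = 1 - Q`, one has `|T| = RTR - QTQ`, so that
`|T| ≤ RAR + QBQ`. -/
theorem traceNorm_sub_le {A B : H →L[ℂ] H} (hA : 0 ≤ A) (hB : 0 ≤ B) :
    traceNorm (A - B) ≤ posTrace A + posTrace B := by
  have hT : IsSelfAdjoint (A - B) := (IsSelfAdjoint.of_nonneg hA).sub (.of_nonneg hB)
  obtain ⟨Q, hQ, h1, h2, h3, h4⟩ := exists_isStarProjection_mul_eq_zero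
    (IsSelfAdjoint.of_nonneg (CFC.posPart_nonneg (A - B)))
    (IsSelfAdjoint.of_nonneg (CFC.negPart_nonneg (A - B))) (CFC.posPart_mul_negPart (A - B))
  have hR : IsStarProjection (1 - Q) := hQ.one_sub
  have key : CFC.abs (A - B) = (1 - Q) * (A - B) * (1 - Q) - Q * (A - B) * Q := by
    rw [← CFC.posPart_add_negPart (A - B) hT]
    conv_rhs => rw [← CFC.posPart_sub_negPart (A - B) hT]
    simp only [mul_sub, sub_mul, one_mul, mul_one, h1, h2, h3, h4, zero_mul]
    abel
  have conj_nonneg {P X : H →L[ℂ] H} (hP : IsStarProjection P) (hX : 0 ≤ X) : 0 ≤ P * X * P :=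
    hP.isSelfAdjoint.conjugate_nonneg hX
  calc traceNorm (A - B)
      ≤ posTrace ((1 - Q) * A * (1 - Q) + Q * B * Q) := by
        rw [traceNorm_eq_posTrace_abs, key]
        refine posTrace_mono (sub_nonneg.1 ?_)
        have h : (1 - Q) * A * (1 - Q) + Q * B * Q -
            ((1 - Q) * (A - B) * (1 - Q) - Q * (A - B) * Q) =
            (1 - Q) * B * (1 - Q) + Q * A * Q := by noncomm_ring
        rw [h]
        exact add_nonneg (conj_nonneg hR hB) (conj_nonneg hQ hA)
    _ = posTrace ((1 - Q) * A * (1 - Q)) + posTrace (Q * B * Q) :=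
        posTrace_add (conj_nonneg hR hA) (conj_nonneg hQ hB)
    _ ≤ posTrace A + posTrace B :=
        add_le_add (hR.posTrace_conj_le hA) (hQ.posTrace_conj_le hB)

theorem traceNorm_neg (T : H →L[ℂ] H) : traceNorm (-T) = traceNorm T := by
  rw [traceNorm_eq_posTrace_abs, CFC.abs_neg, traceNorm_eq_posTrace_abs]

theorem traceNorm_add_le {S T : H →L[ℂ] H} (hS : IsSelfAdjoint S) (hT : IsSelfAdjoint T) :
    traceNorm (S + T) ≤ traceNorm S + traceNorm T := by
  have h : S + T = (S⁺ + T⁺) - (S⁻ + T⁻) := by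
    conv_lhs => rw [← CFC.posPart_sub_negPart S hS, ← CFC.posPart_sub_negPart T hT]
    abel
  have hS1 := CFC.posPart_nonneg S
  have hS2 := CFC.negPart_nonneg S
  have hT1 := CFC.posPart_nonneg T
  have hT2 := CFC.negPart_nonneg T
  calc traceNorm (S + T) ≤ posTrace (S⁺ + T⁺) + posTrace (S⁻ + T⁻) := by
        rw [h]
        exact traceNorm_sub_le (add_nonneg hS1 hT1) (add_nonneg hS2 hT2)
    _ = traceNorm S + traceNorm T := by
        rw [posTrace_add hS1 hT1, posTrace_add hS2 hT2, traceNorm_eq_posTrace_add hS,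
          traceNorm_eq_posTrace_add hT, add_add_add_comm]

theorem traceNorm_sub_le_add {S T : H →L[ℂ] H} (hS : IsSelfAdjoint S) (hT : IsSelfAdjoint T) :
    traceNorm (S - T) ≤ traceNorm S + traceNorm T := by
  simpa only [sub_eq_add_neg, traceNorm_neg] using traceNorm_add_le hS hT.neg

theorem IsStarProjection.traceNorm_conj_le {P : H →L[ℂ] H} (hP : IsStarProjection P)
    {T : H →L[ℂ] H} (hT : IsSelfAdjoint T) : traceNorm (P * T * P) ≤ traceNorm T := by
  have h : P * T * P = P * T⁺ * P - P * T⁻ * P := by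
    conv_lhs => rw [← CFC.posPart_sub_negPart T hT]
    rw [mul_sub, sub_mul]
  have h1 := CFC.posPart_nonneg T
  have h2 := CFC.negPart_nonneg T
  rw [h, traceNorm_eq_posTrace_add hT]
  exact (traceNorm_sub_le (hP.isSelfAdjoint.conjugate_nonneg h1)
    (hP.isSelfAdjoint.conjugate_nonneg h2)).trans
      (add_le_add (hP.posTrace_conj_le h1) (hP.posTrace_conj_le h2))

end TraceNorm

/-! ### Spectral projections on intervals and collimation -/

/-- An interval differs from the open interval with the same endpoints in at most two points. -/
theorem IsIntervalAt.measurableSet {I : Set ℝ} {a₀ w : ℝ} (hI : IsIntervalAt I a₀ w) :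
    MeasurableSet I := by
  obtain ⟨hw, h1, h2⟩ := hI
  have h : I \ Set.Ioo (a₀ - w / 2) (a₀ + w / 2) ⊆ {a₀ - w / 2, a₀ + w / 2} := by
    rintro t ⟨ht, ht'⟩
    rw [← Set.Icc_sdiff_Ioo_same (by linarith)]
    exact ⟨h2 ht, ht'⟩
  rw [← Set.union_sdiff_cancel h1]
  exact measurableSet_Ioo.union ((Set.toFinite _).subset h).measurableSet

theorem mainTheorem7 {H : Type*} [NormedAddCommGroup H] [InnerProductSpace ℂ H] [CompleteSpace H]
    (𝒜 : OStarAlgebra H)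
    (A : Module.End ℂ 𝒜.D) (hA : A ∈ 𝒜.alg) (hsa : 𝒜.IsEssSelfAdjoint A)
    (E : PVM H) (hE : E.IsSpectralMeasureOf (𝒜.toPMap A).closure)
    (I : Set ℝ) (a₀ w : ℝ) (hI : IsIntervalAt I a₀ w)
    (ψ : 𝒜.D) (hψ : A ψ = (a₀ : ℂ) • ψ)
    (ρm : 𝒜.State) (hρm : ρm.op = InnerProductSpace.rankOne ℂ (ψ : H) (ψ : H))
    (ε δ : ℝ) (hδ : 0 < δ) (hδε : δ < ε / 3)
    (hP : traceNorm (E.proj I * ρm.op * E.proj I - ρm.op) < ENNReal.ofReal δ)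
    (hcol : 𝒜.IsSharpCollimated A a₀ w ε (OStarAlgebra.ball ρm δ)) :
    𝒜.IsStrictSharpCollimated A (E.proj I) a₀ w ε (OStarAlgebra.ball ρm δ) := by

  refine ⟨hcol, fun ρ hρ => ?_⟩
  have hproj := E.isProj I hI.measurableSet
  set P := E.proj I
  have hsa_ρ : IsSelfAdjoint ρ.op := ρ.pos.isSelfAdjoint
  have hsa_m : IsSelfAdjoint ρm.op := ρm.pos.isSelfAdjoint
  have hsa_P : IsSelfAdjoint (P * ρm.op * P) := by
    simpa only [hproj.isSelfAdjoint.star_eq] using hsa_m.conjugate P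
  have hsa_d : IsSelfAdjoint (P * (ρ.op - ρm.op) * P) := by
    simpa only [hproj.isSelfAdjoint.star_eq] using (hsa_ρ.sub hsa_m).conjugate P
  have hρ' : traceNorm (ρ.op - ρm.op) < ENNReal.ofReal δ := hρ
  have h : ρ.op - P * ρ.op * P =
      (ρ.op - ρm.op) - (P * ρm.op * P - ρm.op) - P * (ρ.op - ρm.op) * P := by noncomm_ring
  calc traceNorm (ρ.op - P * ρ.op * P)
      ≤ traceNorm (ρ.op - ρm.op) + traceNorm (P * ρm.op * P - ρm.op) +
          traceNorm (P * (ρ.op - ρm.op) * P) := by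
        rw [h]
        refine (traceNorm_sub_le_add ((hsa_ρ.sub hsa_m).sub (hsa_P.sub hsa_m)) hsa_d).trans ?_
        gcongr
        exact traceNorm_sub_le_add (hsa_ρ.sub hsa_m) (hsa_P.sub hsa_m)
    _ < ENNReal.ofReal δ + ENNReal.ofReal δ + ENNReal.ofReal δ :=
        ENNReal.add_lt_add (ENNReal.add_lt_add hρ' hP)
          ((hproj.traceNorm_conj_le (hsa_ρ.sub hsa_m)).trans_lt hρ')
    _ = ENNReal.ofReal (δ + δ + δ) := by
        rw [ENNReal.ofReal_add (by positivity) hδ.le, ENNReal.ofReal_add hδ.le hδ.le]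
    _ ≤ ENNReal.ofReal ε := ENNReal.ofReal_le_ofReal (by linarith)
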